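/- Let $N_1, N_2$ be independent standard normal random variables and let $F_\infty$ be a real random variable with the same law as the product $N_1 N_2$ (for instance $F_\infty = N_1N_2$). Let $\mathfrak{R}$ be the differential operator $(\mathfrak{R}f)(x) = x f(x) - f'(x) - x f''(x)$, and let $P_n := \mathfrak{R}^n \mathbf{1}$ for $n \ge 0$ be the polynomials obtained by applying $\mathfrak{R}$ $n$ times to the constant function $1$. Then for every integer $n \ge 1$ the random variables $P_n(F_\infty)^2$ and $P_{n-1}(F_\infty)P_{n+1}(F_\infty)$ are integrable, and $$\mathbb{E}\big[P_n(F_\infty)^2\big] \;\ge\; \mathbb{E}\big[P_{n-1}(F_\infty)\,P_{n+1}(F_\infty)\big].$$ -/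

import Mathlib

open MeasureTheory ProbabilityTheory

noncomputable section

/-- The Stein operator of the normal product distribution, `(R f)(x) = x f(x) - f'(x) - x f''(x)`,
acting on real polynomials. -/
def steinOp (p : Polynomial ℝ) : Polynomial ℝ :=
  Polynomial.X * p - Polynomial.derivative p
    - Polynomial.X * Polynomial.derivative (Polynomial.derivative p)

/-- The polynomials `P_n = R^n 1`, the `n`-fold iterate of the operator applied to the constant `1`. -/
def steinPoly (n : ℕ) : Polynomial ℝ := steinOp^[n] 1

/-- On polynomial functions, `steinOp` is the differential operator `x f(x) - f'(x) - x f''(x)`. -/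
theorem steinOp_eval (p : Polynomial ℝ) (x : ℝ) :
    (steinOp p).eval x =
      x * p.eval x - deriv (fun y => p.eval y) x - x * deriv (deriv (fun y => p.eval y)) x := by
  have h : ∀ q : Polynomial ℝ, deriv (fun y => q.eval y) = fun y => q.derivative.eval y :=
    fun q => funext fun _ => q.deriv
  rw [h, h]
  simp [steinOp]

end

/-! Substituting x = x₀x₁ turns `steinOp` into A = x₀x₁ - ∂₀∂₁ on polynomials in two Gaussian
variables. With aᵢ = ∂ᵢ and its Gaussian adjoint aᵢ* = `creation i`, A = U + W and A* = V + W, where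
U = a₀*a₁*, V = a₀a₁ and W = a₀*a₁ + a₁*a₀. For f = P_{n-1}(x₀x₁) the claim reads ‖Af‖² ≥ ⟨A*f, Af⟩,
and the difference is (‖Uf‖² - ⟨Uf, Vf⟩) + ⟨f, [V, W]f⟩. The bracket is nonnegative because ‖Vf‖ ≤
‖Uf‖ (`map_pderiv_pderiv_sq_le`). The last term is ⟨f, (a₀² + a₁²)f⟩
(`map_creation_creation_mul_sub`), nonnegative because f has nonnegative Hermite coefficients, a
property that A preserves. -/

open MvPolynomial in
/-- A positive, normalised functional on polynomials that satisfies Gaussian integration by parts. -/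
structure IsGaussianFunctional {σ : Type*} (E : MvPolynomial σ ℝ →ₗ[ℝ] ℝ) : Prop where
  map_one : E 1 = 1
  map_sq_nonneg : ∀ f, 0 ≤ E (f * f)
  map_X_mul : ∀ i f, E (X i * f) = E (pderiv i f)

/-! ### Creation operators and the Hermite-nonnegative cone -/

namespace GaussianPolynomial

open MvPolynomial

/-- The creation operator `f ↦ xᵢ f - ∂ᵢ f`. -/
noncomputable def creation {σ : Type*} (i : σ) : MvPolynomial σ ℝ →ₗ[ℝ] MvPolynomial σ ℝ :=
  LinearMap.mulLeft ℝ (X i) - (pderiv i).toLinearMap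

variable {σ : Type*}

theorem creation_apply (i : σ) (f : MvPolynomial σ ℝ) : creation i f = X i * f - pderiv i f := rfl

theorem pderiv_comm (i j : σ) (f : MvPolynomial σ ℝ) :
    pderiv i (pderiv j f) = pderiv j (pderiv i f) := by
  have h : ⁅pderiv (R := ℝ) i, pderiv (R := ℝ) j⁆ = 0 := by
    classical
    refine MvPolynomial.derivation_ext fun k => ?_
    rw [Derivation.commutator_apply, pderiv_X, pderiv_X]
    simp only [Pi.single_apply]
    split_ifs <;> simp
  have := DFunLike.congr_fun h f
  rw [Derivation.commutator_apply] at this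
  exact sub_eq_zero.mp this

theorem pderiv_creation_self (i : σ) (f : MvPolynomial σ ℝ) :
    pderiv i (creation i f) = f + creation i (pderiv i f) := by
  simp only [creation_apply, map_sub, Derivation.leibniz, pderiv_X_self, smul_eq_mul]
  ring

theorem pderiv_creation_of_ne {i j : σ} (h : j ≠ i) (f : MvPolynomial σ ℝ) :
    pderiv i (creation j f) = creation j (pderiv i f) := by
  simp only [creation_apply, map_sub, Derivation.leibniz, pderiv_X_of_ne h, smul_eq_mul,
    pderiv_comm i j]
  ring

theorem creation_comm (i j : σ) (f : MvPolynomial σ ℝ) :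
    creation i (creation j f) = creation j (creation i f) := by
  obtain rfl | h := eq_or_ne i j
  · rfl
  · rw [creation_apply i, pderiv_creation_of_ne h.symm, creation_apply j, creation_apply j,
      creation_apply j, creation_apply i, map_sub, Derivation.leibniz, pderiv_X_of_ne h,
      smul_eq_mul, smul_eq_mul, pderiv_comm j i]
    ring

/-- Polynomials with nonnegative coefficients in the Hermite basis. -/
inductive HermiteNonneg : MvPolynomial σ ℝ → Prop
  | zero : HermiteNonneg 0
  | one : HermiteNonneg 1
  | add {f g : MvPolynomial σ ℝ} : HermiteNonneg f → HermiteNonneg g → HermiteNonneg (f + g)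
  | creation (i : σ) {f : MvPolynomial σ ℝ} : HermiteNonneg f → HermiteNonneg (creation i f)

theorem HermiteNonneg.pderiv (i : σ) {f : MvPolynomial σ ℝ} (hf : HermiteNonneg f) :
    HermiteNonneg (pderiv i f) := by
  induction hf with
  | zero => simpa using HermiteNonneg.zero
  | one => simpa using HermiteNonneg.zero
  | add _ _ hf hg => simpa using hf.add hg
  | creation j h ih =>
    obtain rfl | hij := eq_or_ne j i
    · rw [pderiv_creation_self]
      exact h.add (ih.creation _)
    · rw [pderiv_creation_of_ne hij]
      exact ih.creation _

end GaussianPolynomial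

namespace IsGaussianFunctional

open MvPolynomial GaussianPolynomial

variable {σ : Type*} {E : MvPolynomial σ ℝ →ₗ[ℝ] ℝ}

theorem map_creation_mul (hE : IsGaussianFunctional E) (i : σ) (f g : MvPolynomial σ ℝ) :
    E (creation i f * g) = E (f * pderiv i g) := by
  have h := hE.map_X_mul i (f * g)
  rw [Derivation.leibniz, map_add, smul_eq_mul, smul_eq_mul] at h
  rw [creation_apply, sub_mul, map_sub, mul_assoc, h, mul_comm g]
  ring

theorem map_mul_creation (hE : IsGaussianFunctional E) (i : σ) (f g : MvPolynomial σ ℝ) :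
    E (f * creation i g) = E (pderiv i f * g) := by
  rw [mul_comm, hE.map_creation_mul, mul_comm]

/-- Adjointness moves each creation operator off f as a derivative of g, which stays in the cone.
What remains is a mean, to which creation terms contribute zero. -/
theorem map_mul_nonneg (hE : IsGaussianFunctional E) {f g : MvPolynomial σ ℝ}
    (hf : HermiteNonneg f) (hg : HermiteNonneg g) : 0 ≤ E (f * g) := by
  induction hf generalizing g with
  | zero => simp
  | one =>
    rw [one_mul]
    induction hg with
    | zero => simp
    | one => simp [hE.map_one]
    | add _ _ hf hg => rw [map_add]; exact add_nonneg hf hg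
    | creation i _ _ =>
      rw [← one_mul (creation i _), hE.map_mul_creation]
      simp
  | add _ _ h₁ h₂ => rw [add_mul, map_add]; exact add_nonneg (h₁ hg) (h₂ hg)
  | creation i _ ih => rw [hE.map_creation_mul]; exact ih (hg.pderiv i)

/-- By the commutation relation, the two sides differ by E(f²). -/
theorem map_pderiv_sq_le (hE : IsGaussianFunctional E) (i : σ) (f : MvPolynomial σ ℝ) :
    E (pderiv i f * pderiv i f) ≤ E (creation i f * creation i f) := by
  rw [hE.map_creation_mul, pderiv_creation_self, mul_add, map_add, hE.map_mul_creation]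
  linarith [hE.map_sq_nonneg f]

theorem map_pderiv_pderiv_sq_le (hE : IsGaussianFunctional E) {i j : σ} (hij : i ≠ j)
    (f : MvPolynomial σ ℝ) :
    E (pderiv i (pderiv j f) * pderiv i (pderiv j f)) ≤
      E (creation i (creation j f) * creation i (creation j f)) := by
  calc _ ≤ E (creation i (pderiv j f) * creation i (pderiv j f)) := hE.map_pderiv_sq_le i _
    _ = E (pderiv j (creation i f) * pderiv j (creation i f)) := by
      rw [pderiv_creation_of_ne hij]
    _ ≤ E (creation j (creation i f) * creation j (creation i f)) := hE.map_pderiv_sq_le j _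
    _ = _ := by rw [creation_comm]

end IsGaussianFunctional

/-! ### The lifted Stein operator and the main inequality -/

namespace GaussianPolynomial

open MvPolynomial

/-- The Stein operator of the normal product, `f ↦ x₀ x₁ f - ∂₀ ∂₁ f`, in two variables. -/
noncomputable def productSteinOp (f : MvPolynomial (Fin 2) ℝ) : MvPolynomial (Fin 2) ℝ :=
  X 0 * X 1 * f - pderiv 0 (pderiv 1 f)

/-- In x₀x₁ = (a₀* + a₀)(a₁* + a₁) the term a₀a₁ cancels against ∂₀∂₁; the positive signs left are
what preserves the cone. -/
theorem productSteinOp_eq (f : MvPolynomial (Fin 2) ℝ) :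
    productSteinOp f = creation 0 (creation 1 f) + creation 0 (pderiv 1 f)
      + creation 1 (pderiv 0 f) := by
  have h : (pderiv 0 (X 1) : MvPolynomial (Fin 2) ℝ) = 0 := pderiv_X_of_ne (by decide)
  simp only [creation_apply, productSteinOp, map_sub, Derivation.leibniz, h, smul_eq_mul]
  rw [pderiv_comm 1 0]
  ring

theorem HermiteNonneg.productSteinOp {f : MvPolynomial (Fin 2) ℝ} (hf : HermiteNonneg f) :
    HermiteNonneg (productSteinOp f) := by
  rw [productSteinOp_eq]
  exact (((hf.creation 1).creation 0).add ((hf.pderiv 1).creation 0)).add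
    ((hf.pderiv 0).creation 1)

end GaussianPolynomial

namespace IsGaussianFunctional

open MvPolynomial GaussianPolynomial

theorem map_mul_le_of_sq_le {σ : Type*} {E : MvPolynomial σ ℝ →ₗ[ℝ] ℝ}
    (hE : IsGaussianFunctional E) {u v : MvPolynomial σ ℝ} (h : E (v * v) ≤ E (u * u)) :
    E (u * v) ≤ E (u * u) := by
  have h₁ := hE.map_sq_nonneg (u - v)
  have h₂ : (u - v) * (u - v) = u * u - u * v - u * v + v * v := by ring
  rw [h₂, map_add, map_sub, map_sub] at h₁
  linarith

variable {E : MvPolynomial (Fin 2) ℝ →ₗ[ℝ] ℝ}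

theorem map_mul_productSteinOp (hE : IsGaussianFunctional E) (f g : MvPolynomial (Fin 2) ℝ) :
    E (f * productSteinOp g) =
      E ((pderiv 0 (pderiv 1 f) + (creation 0 (pderiv 1 f) + creation 1 (pderiv 0 f))) * g) := by
  rw [productSteinOp_eq, mul_add, mul_add, map_add, map_add, hE.map_mul_creation,
    hE.map_mul_creation, hE.map_mul_creation, hE.map_mul_creation,
    ← hE.map_creation_mul 1 (pderiv 0 f), ← hE.map_creation_mul 0 (pderiv 1 f),
    pderiv_comm 1 0, add_mul, add_mul, map_add, map_add]
  ring

/-- Since U* = V and W is self-adjoint, ⟨Uf, Wf⟩ - ⟨Vf, Wf⟩ = ⟨f, [V, W]f⟩, with [V, W] = a₀² + a₁².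
-/
theorem map_creation_creation_mul_sub (hE : IsGaussianFunctional E)
    (f : MvPolynomial (Fin 2) ℝ) :
    E (creation 0 (creation 1 f) * (creation 0 (pderiv 1 f) + creation 1 (pderiv 0 f))) =
      E (pderiv 0 (pderiv 1 f) * (creation 0 (pderiv 1 f) + creation 1 (pderiv 0 f))) +
        E (f * pderiv 0 (pderiv 0 f)) + E (f * pderiv 1 (pderiv 1 f)) := by
  have h01 : (0 : Fin 2) ≠ 1 := by decide
  have hw : pderiv 1 (pderiv 0 (creation 0 (pderiv 1 f) + creation 1 (pderiv 0 f))) =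
      creation 1 (pderiv 0 (pderiv 0 (pderiv 1 f))) + creation 0 (pderiv 1 (pderiv 0 (pderiv 1 f)))
        + pderiv 0 (pderiv 0 f) + pderiv 1 (pderiv 1 f) := by
    rw [map_add, pderiv_creation_self, pderiv_creation_of_ne h01.symm, map_add, map_add,
      pderiv_creation_of_ne h01, pderiv_creation_self, pderiv_comm 1 0 (pderiv 0 f),
      pderiv_comm 1 0 f]
    abel
  rw [hE.map_creation_mul, hE.map_creation_mul, hw, mul_add f, mul_add f, mul_add f, map_add,
    map_add, map_add, hE.map_mul_creation, hE.map_mul_creation, mul_add (pderiv 0 _), map_add,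
    hE.map_mul_creation, hE.map_mul_creation, mul_comm (pderiv 0 (pderiv 0 (pderiv 1 f))),
    mul_comm (pderiv 1 (pderiv 0 (pderiv 1 f)))]

theorem map_mul_productSteinOp_le (hE : IsGaussianFunctional E)
    {f : MvPolynomial (Fin 2) ℝ} (hf : HermiteNonneg f) :
    E (f * productSteinOp (productSteinOp f)) ≤ E (productSteinOp f * productSteinOp f) := by
  have huv := hE.map_mul_le_of_sq_le (hE.map_pderiv_pderiv_sq_le (by decide : (0 : Fin 2) ≠ 1) f)
  have hcomm := hE.map_creation_creation_mul_sub f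
  have hpos : ∀ i, 0 ≤ E (f * pderiv i (pderiv i f)) := fun i =>
    hE.map_mul_nonneg hf ((hf.pderiv i).pderiv i)
  have h0 := hpos 0
  have h1 := hpos 1
  rw [hE.map_mul_productSteinOp, productSteinOp_eq, add_assoc]
  generalize creation 0 (creation 1 f) = u at *
  generalize creation 0 (pderiv 1 f) + creation 1 (pderiv 0 f) = w at *
  generalize pderiv 0 (pderiv 1 f) = v at *
  have e₁ : (v + w) * (u + w) = u * v + v * w + u * w + w * w := by ring
  have e₂ : (u + w) * (u + w) = u * u + u * w + u * w + w * w := by ring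
  rw [e₁, e₂]
  simp only [map_add]
  linarith

end IsGaussianFunctional

/-! ### Transfer from one variable to two -/

namespace GaussianPolynomial

open MvPolynomial

/-- Substitution of the product `x₀ x₁` into a univariate polynomial. -/
noncomputable def evalProduct : Polynomial ℝ →ₐ[ℝ] MvPolynomial (Fin 2) ℝ := Polynomial.aeval (X 0 * X 1)

theorem evalProduct_steinOp (p : Polynomial ℝ) :
    evalProduct (steinOp p) = productSteinOp (evalProduct p) := by
  have hd : ∀ i (q : Polynomial ℝ), pderiv i (evalProduct q) =
      evalProduct q.derivative * pderiv i (X 0 * X 1) := fun i q => by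
    simp only [evalProduct]
    rw [Derivation.map_aeval, smul_eq_mul]
  have h0 : (pderiv 0 (X 0 * X 1) : MvPolynomial (Fin 2) ℝ) = X 1 := by
    rw [Derivation.leibniz, pderiv_X_of_ne (by decide), pderiv_X_self]
    simp
  have h1 : (pderiv 1 (X 0 * X 1) : MvPolynomial (Fin 2) ℝ) = X 0 := by
    rw [Derivation.leibniz, pderiv_X_self, pderiv_X_of_ne (by decide)]
    simp
  have h00 : (pderiv 0 (X 0) : MvPolynomial (Fin 2) ℝ) = 1 := pderiv_X_self 0
  have hX : evalProduct Polynomial.X = X 0 * X 1 := by simp [evalProduct]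
  rw [steinOp, map_sub, map_sub, map_mul, map_mul, hX, productSteinOp, hd, h1, Derivation.leibniz,
    hd, h0, h00, smul_eq_mul, smul_eq_mul]
  ring

theorem steinPoly_succ (n : ℕ) : steinPoly (n + 1) = steinOp (steinPoly n) :=
  Function.iterate_succ_apply' _ _ _

theorem hermiteNonneg_evalProduct_steinPoly (n : ℕ) : HermiteNonneg (evalProduct (steinPoly n)) := by
  induction n with
  | zero => simpa [steinPoly] using HermiteNonneg.one
  | succ n ih =>
    rw [steinPoly_succ, evalProduct_steinOp]
    exact ih.productSteinOp

theorem _root_.IsGaussianFunctional.map_steinPoly_le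
    {E : MvPolynomial (Fin 2) ℝ →ₗ[ℝ] ℝ} (hE : IsGaussianFunctional E) (n : ℕ) :
    E (evalProduct (steinPoly n * steinPoly (n + 2))) ≤
      E (evalProduct (steinPoly (n + 1) ^ 2)) := by
  rw [map_mul evalProduct, sq, map_mul evalProduct, steinPoly_succ (n + 1), steinPoly_succ n, evalProduct_steinOp,
    evalProduct_steinOp]
  exact hE.map_mul_productSteinOp_le (hermiteNonneg_evalProduct_steinPoly n)

end GaussianPolynomial

/-! ### Gaussian moments and the concrete expectation -/

theorem integrable_pow_gaussianReal (k : ℕ) :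
    Integrable (fun x : ℝ => x ^ k) (gaussianReal 0 1) := by
  have h := (memLp_id_gaussianReal (μ := 0) (v := 1) k).integrable_norm_pow'
  refine h.mono' (by fun_prop) (ae_of_all _ fun x => ?_)
  simp

theorem hasDerivAt_gaussianPDFReal_zero_one (x : ℝ) :
    HasDerivAt (gaussianPDFReal 0 1) (-x * gaussianPDFReal 0 1 x) x := by
  have hdef : gaussianPDFReal 0 1 =
      fun y : ℝ => (√(2 * Real.pi))⁻¹ * Real.exp (-y ^ 2 / 2) := by
    ext y
    simp [gaussianPDFReal]
  have h : HasDerivAt (fun y : ℝ => -y ^ 2 / 2) (-x) x :=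
    ((hasDerivAt_pow 2 x).neg.div_const 2).congr_deriv (by simp; ring)
  rw [hdef]
  exact (h.exp.const_mul _).congr_deriv (by ring)

/-- The derivative of φ(x)xᵏ, with φ the Gaussian density, integrates to zero. At k = 0 the
truncated k - 1 is harmless: its factor k vanishes. -/
theorem integral_pow_succ_gaussianReal (k : ℕ) :
    ∫ x, x ^ (k + 1) ∂gaussianReal 0 1 = k * ∫ x, x ^ (k - 1) ∂gaussianReal 0 1 := by
  have hint : ∀ m : ℕ, Integrable (fun x => gaussianPDFReal 0 1 x * x ^ m) := fun m => by
    have h := integrable_pow_gaussianReal m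
    rw [gaussianReal_of_var_ne_zero _ one_ne_zero, integrable_withDensity_iff_integrable_smul'
      (measurable_gaussianPDF 0 1) (ae_of_all _ fun _ => gaussianPDF_lt_top)] at h
    simpa [toReal_gaussianPDF] using h
  have hderiv : ∀ x : ℝ, HasDerivAt (fun y => gaussianPDFReal 0 1 y * y ^ k)
      (k * (gaussianPDFReal 0 1 x * x ^ (k - 1)) - gaussianPDFReal 0 1 x * x ^ (k + 1)) x :=
    fun x =>
      ((hasDerivAt_gaussianPDFReal_zero_one x).mul (hasDerivAt_pow k x)).congr_deriv (by ring)
  have h := integral_eq_zero_of_hasDerivAt_of_integrable hderiv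
    (((hint (k - 1)).const_mul _).sub (hint (k + 1))) (hint k)
  rw [integral_sub ((hint (k - 1)).const_mul _) (hint (k + 1)), integral_const_mul] at h
  simp only [integral_gaussianReal_eq_integral_smul one_ne_zero, smul_eq_mul]
  linarith

section Pair

open MvPolynomial

variable {Ω : Type*} [MeasurableSpace Ω] {P : Measure Ω} {N₁ N₂ : Ω → ℝ}

theorem integrable_pow_of_hasLaw_gaussianReal {N : Ω → ℝ} (hN : HasLaw N (gaussianReal 0 1) P)
    (k : ℕ) : Integrable (fun ω => N ω ^ k) P := by
  have h := integrable_pow_gaussianReal k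
  rw [← hN.map_eq] at h
  exact h.comp_aemeasurable hN.aemeasurable

theorem integral_pow_of_hasLaw_gaussianReal {N : Ω → ℝ} (hN : HasLaw N (gaussianReal 0 1) P)
    (k : ℕ) : ∫ ω, N ω ^ k ∂P = ∫ x, x ^ k ∂gaussianReal 0 1 :=
  hN.integral_comp (f := fun x => x ^ k) (by fun_prop)

theorem eval_pair_monomial (s : Fin 2 →₀ ℕ) (c x y : ℝ) :
    eval ![x, y] (monomial s c) = c * (x ^ s 0 * y ^ s 1) := by
  rw [eval_monomial, Finsupp.prod_fintype _ _ (by simp)]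
  simp

theorem integrable_eval_pair (hN₁ : HasLaw N₁ (gaussianReal 0 1) P)
    (hN₂ : HasLaw N₂ (gaussianReal 0 1) P) (hindep : IndepFun N₁ N₂ P)
    (f : MvPolynomial (Fin 2) ℝ) : Integrable (fun ω => eval ![N₁ ω, N₂ ω] f) P := by
  induction f using MvPolynomial.induction_on' with
  | monomial s c =>
    simp only [eval_pair_monomial]
    exact ((hindep.comp (measurable_id.pow_const (s 0))
      (measurable_id.pow_const (s 1))).integrable_mul
        (integrable_pow_of_hasLaw_gaussianReal hN₁ _)
        (integrable_pow_of_hasLaw_gaussianReal hN₂ _)).const_mul c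
  | add f g hf hg =>
    simp only [map_add]
    exact hf.add hg

theorem integral_eval_pair_monomial (hN₁ : HasLaw N₁ (gaussianReal 0 1) P)
    (hN₂ : HasLaw N₂ (gaussianReal 0 1) P) (hindep : IndepFun N₁ N₂ P) (s : Fin 2 →₀ ℕ) (c : ℝ) :
    ∫ ω, eval ![N₁ ω, N₂ ω] (monomial s c) ∂P =
      c * ((∫ x, x ^ s 0 ∂gaussianReal 0 1) * ∫ x, x ^ s 1 ∂gaussianReal 0 1) := by
  simp only [eval_pair_monomial]
  rw [integral_const_mul, hindep.integral_fun_comp_mul_comp (f := fun x => x ^ s 0)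
    (g := fun x => x ^ s 1) hN₁.aemeasurable hN₂.aemeasurable (by fun_prop) (by fun_prop),
    integral_pow_of_hasLaw_gaussianReal hN₁, integral_pow_of_hasLaw_gaussianReal hN₂]

/-- The expectation of a polynomial in two independent standard normal variables. -/
noncomputable def gaussianPairExpectation (hN₁ : HasLaw N₁ (gaussianReal 0 1) P)
    (hN₂ : HasLaw N₂ (gaussianReal 0 1) P) (hindep : IndepFun N₁ N₂ P) :
    MvPolynomial (Fin 2) ℝ →ₗ[ℝ] ℝ where
  toFun f := ∫ ω, eval ![N₁ ω, N₂ ω] f ∂P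
  map_add' f g := by
    simp only [map_add]
    exact integral_add (integrable_eval_pair hN₁ hN₂ hindep f)
      (integrable_eval_pair hN₁ hN₂ hindep g)
  map_smul' c f := by simp [smul_eval, integral_const_mul]

theorem gaussianPairExpectation_apply (hN₁ : HasLaw N₁ (gaussianReal 0 1) P)
    (hN₂ : HasLaw N₂ (gaussianReal 0 1) P) (hindep : IndepFun N₁ N₂ P)
    (f : MvPolynomial (Fin 2) ℝ) :
    gaussianPairExpectation hN₁ hN₂ hindep f = ∫ ω, eval ![N₁ ω, N₂ ω] f ∂P := rfl

theorem isGaussianFunctional_gaussianPairExpectation [IsProbabilityMeasure P]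
    (hN₁ : HasLaw N₁ (gaussianReal 0 1) P)
    (hN₂ : HasLaw N₂ (gaussianReal 0 1) P) (hindep : IndepFun N₁ N₂ P) :
    IsGaussianFunctional (gaussianPairExpectation hN₁ hN₂ hindep) where
  map_one := by simp [gaussianPairExpectation_apply]
  map_sq_nonneg f := by
    rw [gaussianPairExpectation_apply]
    exact integral_nonneg fun ω => by rw [map_mul]; exact mul_self_nonneg _
  map_X_mul i f := by
    induction f using MvPolynomial.induction_on' with
    | monomial s c =>
      rw [pderiv_monomial, X, monomial_mul, one_mul, gaussianPairExpectation_apply,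
        gaussianPairExpectation_apply, integral_eval_pair_monomial hN₁ hN₂ hindep,
        integral_eval_pair_monomial hN₁ hN₂ hindep]
      fin_cases i
      · simp [add_comm 1, integral_pow_succ_gaussianReal]
        ring
      · simp [add_comm 1, integral_pow_succ_gaussianReal]
        ring
    | add f g hf hg => rw [mul_add, map_add, map_add, map_add, hf, hg]

end Pair

open MvPolynomial GaussianPolynomial in
theorem eval_evalProduct (p : Polynomial ℝ) (x y : ℝ) :
    eval ![x, y] (evalProduct p) = p.eval (x * y) := by
  rw [← coe_aeval_eq_eval]
  change aeval ![x, y] (Polynomial.aeval (X 0 * X 1) p) = _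
  rw [← Polynomial.aeval_algHom_apply]
  simp [Polynomial.aeval_def, Polynomial.eval₂_eq_eval_map]

theorem proposition3p4
    {Ω : Type*} [MeasurableSpace Ω] (P : Measure Ω) [IsProbabilityMeasure P]
    (N₁ N₂ : Ω → ℝ)
    (hN₁ : HasLaw N₁ (gaussianReal 0 1) P) (hN₂ : HasLaw N₂ (gaussianReal 0 1) P)
    (hindep : IndepFun N₁ N₂ P)
    {Ω' : Type*} [MeasurableSpace Ω'] (P' : Measure Ω') [IsProbabilityMeasure P']
    (F : Ω' → ℝ) (hF : IdentDistrib F (fun ω => N₁ ω * N₂ ω) P' P)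
    (n : ℕ) (hn : 1 ≤ n) :
    Integrable (fun ω => ((steinPoly n).eval (F ω)) ^ 2) P' ∧
    Integrable (fun ω => (steinPoly (n - 1)).eval (F ω) * (steinPoly (n + 1)).eval (F ω)) P' ∧
    ∫ ω, ((steinPoly n).eval (F ω)) ^ 2 ∂P' ≥
      ∫ ω, (steinPoly (n - 1)).eval (F ω) * (steinPoly (n + 1)).eval (F ω) ∂P' := by
  have hident : ∀ p : Polynomial ℝ,
      IdentDistrib (fun ω => p.eval (F ω)) (fun ω => p.eval (N₁ ω * N₂ ω)) P' P :=
    fun p => hF.comp p.continuous.measurable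
  have hint : ∀ p : Polynomial ℝ, Integrable (fun ω => p.eval (F ω)) P' := fun p => by
    rw [(hident p).integrable_iff]
    simpa only [eval_evalProduct] using
      integrable_eval_pair hN₁ hN₂ hindep (GaussianPolynomial.evalProduct p)
  have hexp : ∀ p : Polynomial ℝ, ∫ ω, p.eval (F ω) ∂P' =
      gaussianPairExpectation hN₁ hN₂ hindep (GaussianPolynomial.evalProduct p) := fun p => by
    rw [(hident p).integral_eq, gaussianPairExpectation_apply]
    simp only [eval_evalProduct]
  obtain ⟨m, rfl⟩ := Nat.exists_eq_add_of_le' hn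
  have hle := (isGaussianFunctional_gaussianPairExpectation hN₁ hN₂ hindep).map_steinPoly_le m
  rw [← hexp, ← hexp] at hle
  have h₁ := hint (steinPoly (m + 1) ^ 2)
  have h₂ := hint (steinPoly m * steinPoly (m + 2))
  simp only [Polynomial.eval_pow, Polynomial.eval_mul] at h₁ h₂ hle
  exact ⟨h₁, h₂, hle⟩
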